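/- Let $\gamma\subset\mathbb R^2$ be a smooth ($C^\infty$) strictly convex oval, that is, a smooth closed regular simple curve, oriented counterclockwise, such that every tangent line meets $\gamma$ only at its point of tangency and the rest of $\gamma$ lies strictly on the left of it (the curvature may vanish at some points). The outer length billiard map $T$ acts on the exterior of $\gamma$ as follows. For a point $M$ of the exterior, let the two tangent lines from $M$ to $\gamma$ touch $\gamma$ at $\gamma(x_1)$ and $\gamma(x_2)$, where $M$ lies ahead of $\gamma(x_1)$ and behind $\gamma(x_2)$ with respect to the orientation of $\gamma$. Let $C$ be the unique circle that touches $\gamma$ from outside at $\gamma(x_2)$ and is tangent to the tangent line of $\gamma$ at $\gamma(x_1)$. Then $T(M)$ is the intersection point of the tangent line at $\gamma(x_2)$ with the third common tangent line of $C$ and $\gamma$ (the one different from the tangent lines at $\gamma(x_1)$ and $\gamma(x_2)$). A point $M$ of the exterior is called $n$-periodic if $T^n(M)=M$. Theorem. For every such oval $\gamma$, the set of 3-periodic points and the set of 4-periodic points of the outer length billiard map about $\gamma$ both have empty interior in the plane. -/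

import Mathlib

open scoped ContDiff

noncomputable section

namespace OuterLengthBilliard

/-- The Euclidean plane. -/
abbrev Plane : Type := EuclideanSpace ℝ (Fin 2)

/-- The determinant of two plane vectors; it is positive iff `v` points strictly to the left
of the direction `u`. -/
def det (u v : Plane) : ℝ := u 0 * v 1 - u 1 * v 0

/-- A smooth strictly convex oval, as a counterclockwise 1-periodic parametrised curve.
Strict convexity: the tangent line at `γ s` meets the curve only at `γ s`, and all the other
points of the curve lie strictly to the left of it. In particular the velocity never vanishes
and the closed curve is simple. The curvature is allowed to vanish at some points. -/
structure IsOval (γ : ℝ → Plane) : Prop where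
  smooth : ContDiff ℝ ∞ γ
  periodic : Function.Periodic γ 1
  strictly_convex : ∀ s t : ℝ, (∀ k : ℤ, t ≠ s + k) → 0 < det (deriv γ s) (γ t - γ s)

/-- The exterior of the oval: the complement of the closed convex domain that it bounds. -/
def exterior (γ : ℝ → Plane) : Set Plane := (convexHull ℝ (Set.range γ))ᶜ

/-- The tangent line of the curve `γ` at the point `γ x`. -/
def tangentLine (γ : ℝ → Plane) (x : ℝ) : AffineSubspace ℝ Plane :=
  AffineSubspace.mk' (γ x) (Submodule.span ℝ {deriv γ x})

/-- `M` lies on the tangent line at `γ x`, strictly ahead of `γ x`. -/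
def IsAhead (γ : ℝ → Plane) (x : ℝ) (M : Plane) : Prop :=
  ∃ l : ℝ, 0 < l ∧ M = γ x + l • deriv γ x

/-- `M` lies on the tangent line at `γ x`, strictly behind `γ x`. -/
def IsBehind (γ : ℝ → Plane) (x : ℝ) (M : Plane) : Prop :=
  ∃ l : ℝ, 0 < l ∧ M = γ x - l • deriv γ x

/-- The graph of the outer length billiard map: `T M = M'`.
The tangent lines from `M` to the oval touch it at `γ x₁` and `γ x₂` (with `γ x₁` behind `M`
and `γ x₂` ahead of `M`). The circle `C` touches the oval from outside at `γ x₂` and is tangent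
to the tangent line at `γ x₁`. The point `M'` lies on the tangent line at `γ x₂`, past `γ x₂`,
and the other tangent line from `M'` to the oval, the one at `γ x₃`, is also tangent to `C`. -/
def Maps (γ : ℝ → Plane) (M M' : Plane) : Prop :=
  ∃ (x₁ x₂ x₃ : ℝ) (C : EuclideanGeometry.Sphere Plane),
    IsAhead γ x₁ M ∧ IsBehind γ x₂ M ∧
    0 < C.radius ∧
    C.IsTangentAt (γ x₂) (tangentLine γ x₂) ∧
    det (deriv γ x₂) (C.center - γ x₂) < 0 ∧
    C.IsTangent (tangentLine γ x₁) ∧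
    IsAhead γ x₂ M' ∧ IsBehind γ x₃ M' ∧
    C.IsTangent (tangentLine γ x₃)

/-- The set of `n`-periodic points of the outer length billiard map `T`, that is, the points
`M` of the exterior of the oval with `T^n M = M`. -/
def periodicPoints (γ : ℝ → Plane) (n : ℕ) : Set Plane :=
  {M | M ∈ exterior γ ∧ ∃ P : ℕ → Plane,
    P 0 = M ∧ P n = M ∧ ∀ i < n, Maps γ (P i) (P (i + 1))}

end OuterLengthBilliard

end

/-!
The tangent points `γ x₁, γ x₂, …` of the tangent lines through a billiard orbit form a
circumscribed polygon. At each tangent point `γ xᵢ` the circle in the definition of the map is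
tangent both to the line before and to the line after; its radius can be computed from either of
them, so that `backwardRadius γ xᵢ₋₁ xᵢ = forwardRadius γ xᵢ xᵢ₊₁`
(`Maps.exists_turn`). If `δ` is the angle of the turn from `x` to `y`, and `a`, `b` are the tangent
lengths from the vertex to `γ x` and `γ y`, then
`forwardRadius γ x y = a tan (δ / 2) = dist (γ x, line y) / (1 + cos δ)`, and
`backwardRadius γ x y = b tan (δ / 2) = dist (γ y, line x) / (1 + cos δ)`.
These formulas show that both radii strictly increase when `y` advances and strictly decrease when
`x` advances (`Turn.forwardRadius_lt_right` and the three lemmas after it). This is a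
discrete twist condition, and neither derivatives of the map nor positive curvature are needed.

A polygon with three or four sides closes up after one revolution. Compare two periodic orbits with
the same first tangent point `x₁`, and suppose that `x₂` advances. The equality of radii at `x₁`
forces the last point to move back (`lt_of_radius_eq`), and the equality at `x₂` forces `x₃` to
advance (`lt_of_radius_eq'`). For a triangle `x₃` is the last point, a contradiction. For a
quadrilateral, `x₃` advances and `x₄` moves back, so that at `x₄` the backward radius decreases
while the forward radius increases, a contradiction again. Hence `x₁` determines `x₂`, and a ray of
a tangent line, issuing from the point of tangency, contains at most one periodic point of each of
these periods. A set with this property has empty interior.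
-/

namespace OuterLengthBilliard

/-! ### Determinants and unit vectors in the plane -/

theorem det_swap (u v : Plane) : det u v = -det v u := by
  simp only [det]; ring

theorem det_self (u : Plane) : det u u = 0 := by
  simp only [det]; ring

theorem det_add_right (u v w : Plane) : det u (v + w) = det u v + det u w := by
  simp only [det, PiLp.add_apply]; ring

theorem det_sub_right (u v w : Plane) : det u (v - w) = det u v - det u w := by
  simp only [det, PiLp.sub_apply]; ring

theorem det_smul_right (c : ℝ) (u v : Plane) : det u (c • v) = c * det u v := by
  simp only [det, PiLp.smul_apply, smul_eq_mul]; ring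

theorem det_smul_left (c : ℝ) (u v : Plane) : det (c • u) v = c * det u v := by
  simp only [det, PiLp.smul_apply, smul_eq_mul]; ring

theorem inner_eq_coord (u v : Plane) : inner ℝ u v = u 0 * v 0 + u 1 * v 1 := by
  simp [PiLp.inner_apply, Fin.sum_univ_two, mul_comm]

theorem coord_sq_of_norm_eq_one {u : Plane} (hu : ‖u‖ = 1) : u 0 * u 0 + u 1 * u 1 = 1 := by
  rw [← inner_eq_coord, real_inner_self_eq_norm_sq, hu, one_pow]

/-- Lagrange's identity in the plane. -/
theorem inner_sq_add_det_sq (u v : Plane) :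
    inner ℝ u v ^ 2 + det u v ^ 2 = ‖u‖ ^ 2 * ‖v‖ ^ 2 := by
  rw [← real_inner_self_eq_norm_sq, ← real_inner_self_eq_norm_sq]
  simp only [inner_eq_coord, det]; ring

theorem one_add_inner_pos {X Y : Plane} (hX : ‖X‖ = 1) (hY : ‖Y‖ = 1) (h : 0 < det X Y) :
    0 < 1 + inner ℝ X Y := by
  have := inner_sq_add_det_sq X Y
  rw [hX, hY] at this
  nlinarith [sq_nonneg (1 + inner ℝ X Y), mul_pos h h]

theorem inner_lt_one {X Y : Plane} (hX : ‖X‖ = 1) (hY : ‖Y‖ = 1) (h : 0 < det X Y) :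
    inner ℝ X Y < 1 := by
  have := inner_sq_add_det_sq X Y
  rw [hX, hY] at this
  nlinarith [sq_nonneg (1 - inner ℝ X Y), mul_pos h h]

/-- Cramer's rule: the coordinates of `V` in the basis `X, Y`. -/
theorem det_smul_eq (X Y V : Plane) : det X Y • V = det V Y • X + det X V • Y := by
  ext i
  fin_cases i <;> simp [det] <;> ring

/-- The cosine decreases when the second direction turns further to the left. -/
theorem inner_lt_inner_left {X Y Z : Plane} (hY : ‖Y‖ = 1) (hZ : ‖Z‖ = 1)
    (hXY : 0 < det X Y) (hYZ : 0 < det Y Z) (hXZ : 0 < det X Z) :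
    inner ℝ X Z < inner ℝ X Y := by
  have hlt := inner_lt_one hY hZ hYZ
  have hz := coord_sq_of_norm_eq_one hZ
  have hy := coord_sq_of_norm_eq_one hY
  -- `sin ε (cos δ - cos δ') = (1 - cos ε) (sin δ' + sin δ)` with `δ' = δ + ε`
  have key : det Y Z * (inner ℝ X Y - inner ℝ X Z)
      = (1 - inner ℝ Y Z) * (det X Z + det X Y) := by
    have hL := inner_sq_add_det_sq Y Z
    rw [hY, hZ] at hL
    have h1 : inner ℝ X Y = inner ℝ X Z * inner ℝ Y Z + det X Z * det Y Z := by
      simp only [inner_eq_coord, det]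
      linear_combination (-(X 0 * Y 0 + X 1 * Y 1)) * hz
    have h2 : det X Y = det X Z * inner ℝ Y Z - inner ℝ X Z * det Y Z := by
      simp only [inner_eq_coord, det]
      linear_combination (-(X 0 * Y 1 - X 1 * Y 0)) * hz
    rw [h1, h2]
    linear_combination det X Z * hL
  have : 0 < det Y Z * (inner ℝ X Y - inner ℝ X Z) := by
    rw [key]; exact mul_pos (by linarith) (by linarith)
  have := pos_of_mul_pos_right this hYZ.le
  linarith

/-- The cosine increases when the first direction turns to the left, towards the second. -/
theorem inner_lt_inner_right {X Y Z : Plane} (hX : ‖X‖ = 1) (hY : ‖Y‖ = 1)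
    (hXY : 0 < det X Y) (hYZ : 0 < det Y Z) (hXZ : 0 < det X Z) :
    inner ℝ X Z < inner ℝ Y Z := by
  have hlt := inner_lt_one hX hY hXY
  have hx := coord_sq_of_norm_eq_one hX
  have key : det X Y * (inner ℝ Y Z - inner ℝ X Z)
      = (1 - inner ℝ X Y) * (det X Z + det Y Z) := by
    have hL := inner_sq_add_det_sq X Y
    rw [hX, hY] at hL
    have h1 : inner ℝ Y Z = inner ℝ X Y * inner ℝ X Z + det X Y * det X Z := by
      simp only [inner_eq_coord, det]
      linear_combination (-(Y 0 * Z 0 + Y 1 * Z 1)) * hx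
    have h2 : det Y Z = inner ℝ X Y * det X Z - det X Y * inner ℝ X Z := by
      simp only [inner_eq_coord, det]
      linear_combination (-(Y 0 * Z 1 - Y 1 * Z 0)) * hx
    rw [h1, h2]
    linear_combination det X Z * hL
  have : 0 < det X Y * (inner ℝ Y Z - inner ℝ X Z) := by
    rw [key]; exact mul_pos (by linarith) (by linarith)
  have := pos_of_mul_pos_right this hXY.le
  linarith

/-- `tan (δ / 2) = sin δ / (1 + cos δ)` increases when the second direction turns further to
the left. -/
theorem tan_half_lt_left {X Y Z : Plane} (hX : ‖X‖ = 1) (hY : ‖Y‖ = 1) (hZ : ‖Z‖ = 1)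
    (hXY : 0 < det X Y) (hYZ : 0 < det Y Z) (hXZ : 0 < det X Z) :
    det X Y / (1 + inner ℝ X Y) < det X Z / (1 + inner ℝ X Z) := by
  have hlt := inner_lt_one hX hY hXY
  have hp := one_add_inner_pos hX hZ hXZ
  rw [div_lt_div_iff₀ (one_add_inner_pos hX hY hXY) hp]
  have h1 : det Y Z = inner ℝ X Y * det X Z - det X Y * inner ℝ X Z := by
    simp only [inner_eq_coord, det]
    linear_combination (-(Y 0 * Z 1 - Y 1 * Z 0)) * coord_sq_of_norm_eq_one hX
  have hlt' := inner_lt_one hY hZ hYZ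
  have h2 : det X Y = det X Z * inner ℝ Y Z - inner ℝ X Z * det Y Z := by
    simp only [inner_eq_coord, det]
    linear_combination (-(X 0 * Y 1 - X 1 * Y 0)) * coord_sq_of_norm_eq_one hZ
  -- the difference is `sin δ' - sin δ + sin ε = sin δ' (1 - cos ε) + sin ε (1 + cos δ')`
  nlinarith [mul_pos hXZ (sub_pos.2 hlt'), mul_pos hYZ hp]

theorem tan_half_lt_right {X Y Z : Plane} (hX : ‖X‖ = 1) (hY : ‖Y‖ = 1) (hZ : ‖Z‖ = 1)
    (hXY : 0 < det X Y) (hYZ : 0 < det Y Z) (hXZ : 0 < det X Z) :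
    det Y Z / (1 + inner ℝ Y Z) < det X Z / (1 + inner ℝ X Z) := by
  have hlt := inner_lt_one hX hY hXY
  have hp := one_add_inner_pos hX hZ hXZ
  rw [div_lt_div_iff₀ (one_add_inner_pos hY hZ hYZ) hp]
  have h1 : det Y Z = inner ℝ X Y * det X Z - det X Y * inner ℝ X Z := by
    simp only [inner_eq_coord, det]
    linear_combination (-(Y 0 * Z 1 - Y 1 * Z 0)) * coord_sq_of_norm_eq_one hX
  have h2 : det X Y = det X Z * inner ℝ Y Z - inner ℝ X Z * det Y Z := by
    simp only [inner_eq_coord, det]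
    linear_combination (-(X 0 * Y 1 - X 1 * Y 0)) * coord_sq_of_norm_eq_one hZ
  nlinarith [mul_pos hXZ (sub_pos.2 hlt), mul_pos hXY hp]

/-! ### Tangent directions of an oval -/

section Oval

variable {γ : ℝ → Plane}

theorem deriv_add_int (h : Function.Periodic γ 1) (x : ℝ) (k : ℤ) :
    deriv γ (x + k) = deriv γ x := by
  have hk : (fun y => γ (y + k)) = γ := funext fun y => by simpa using h.int_mul k y
  rw [← deriv_comp_add_const, hk]

theorem apply_add_int (h : Function.Periodic γ 1) (x : ℝ) (k : ℤ) : γ (x + k) = γ x := by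
  simpa using h.int_mul k x

theorem deriv_add_one (h : Function.Periodic γ 1) (x : ℝ) : deriv γ (x + 1) = deriv γ x := by
  simpa using deriv_add_int h x 1

theorem ne_add_int_of_lt {x y : ℝ} (h : x < y) (h1 : y < x + 1) (k : ℤ) : y ≠ x + k := by
  rintro rfl
  have h0 : (0 : ℝ) < k := by linarith
  have h1 : (k : ℝ) < 1 := by linarith
  norm_cast at h0 h1
  omega

theorem ne_add_int_symm {x y : ℝ} (h : ∀ k : ℤ, y ≠ x + k) (k : ℤ) : x ≠ y + k := by
  intro e
  refine h (-k) ?_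
  push_cast; linarith

theorem exists_add_int_of_forall_ne {x y : ℝ} (h : ∀ k : ℤ, y ≠ x + k) :
    ∃ k : ℤ, x < y + k ∧ y + k < x + 1 := by
  refine ⟨-⌊y - x⌋, ?_, ?_⟩
  · have := Int.floor_le (y - x)
    have hne := h ⌊y - x⌋
    push_cast
    rcases this.lt_or_eq with h' | h'
    · linarith
    · exact absurd (by linarith) hne
  · have := Int.lt_floor_add_one (y - x)
    push_cast; linarith

theorem IsOval.deriv_ne_zero (hγ : IsOval γ) (x : ℝ) : deriv γ x ≠ 0 := by
  intro h
  have := hγ.strictly_convex x (x + 1 / 2)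
    (ne_add_int_of_lt (by linarith) (by linarith))
  simp [h, det] at this

/-- Two parallel tangents at different points of the oval have opposite directions. -/
theorem IsOval.exists_neg_of_det_eq_zero (hγ : IsOval γ) {x y : ℝ} (hxy : ∀ k : ℤ, y ≠ x + k)
    (h : det (deriv γ x) (deriv γ y) = 0) : ∃ c : ℝ, 0 < c ∧ deriv γ x = -c • deriv γ y := by
  obtain ⟨c, hc⟩ : ∃ c : ℝ, deriv γ x = c • deriv γ y := by
    have hn := real_inner_self_pos.2 (hγ.deriv_ne_zero y)
    refine ⟨inner ℝ (deriv γ x) (deriv γ y) / inner ℝ (deriv γ y) (deriv γ y), ?_⟩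
    rw [div_eq_inv_mul, mul_smul, eq_inv_smul_iff₀ hn.ne']
    simp only [det] at h
    simp only [inner_eq_coord]
    ext i
    fin_cases i
    · simp; linear_combination deriv γ y 1 * h
    · simp; linear_combination (-deriv γ y 0) * h
  refine ⟨-c, ?_, by rw [neg_neg, hc]⟩
  have h1 := hγ.strictly_convex x y hxy
  have h2 := hγ.strictly_convex y x (ne_add_int_symm hxy)
  rw [hc, det_smul_left, ← neg_sub, ← neg_one_smul ℝ, det_smul_right] at h1
  by_contra hcn
  nlinarith

theorem IsOval.continuous_det_deriv (hγ : IsOval γ) (u : Plane) :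
    Continuous fun y => det u (deriv γ y) := by
  have h : Continuous (deriv γ) := hγ.smooth.continuous_deriv (by simp)
  simp only [det]
  fun_prop

theorem IsOval.hasDerivAt_det (hγ : IsOval γ) (u v : Plane) (y : ℝ) :
    HasDerivAt (fun y => det u (γ y - v)) (det u (deriv γ y)) y := by
  have h : HasDerivAt γ (deriv γ y) y :=
    (hγ.smooth.differentiable (by simp)).differentiableAt.hasDerivAt
  have h0 := hasDerivAt_pi.1 ((PiLp.hasFDerivAt_ofLp 2 (γ y)).comp_hasDerivAt y h)
  have h1 := ((h0 1).sub_const (v 1)).const_mul (u 0)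
  have h2 := ((h0 0).sub_const (v 0)).const_mul (u 1)
  exact h1.sub h2


/-- Between `x` and `x + 1` there is at most one tangent parallel to the one at `x`: at such a
point the distance from the tangent line at `γ x` has its strict global maximum. -/
theorem IsOval.eq_of_det_eq_zero (hγ : IsOval γ) {x y z : ℝ} (hy : x < y) (hy1 : y < x + 1)
    (hz : x < z) (hz1 : z < x + 1) (h : det (deriv γ x) (deriv γ y) = 0)
    (h' : det (deriv γ x) (deriv γ z) = 0) : y = z := by
  by_contra hne
  have hzy : ∀ k : ℤ, z ≠ y + k := by
    rcases lt_or_gt_of_ne hne with hlt | hlt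
    · exact ne_add_int_of_lt hlt (by linarith)
    · exact ne_add_int_symm (ne_add_int_of_lt hlt (by linarith))
  obtain ⟨c, hc, hxy⟩ := hγ.exists_neg_of_det_eq_zero (ne_add_int_of_lt hy hy1) h
  obtain ⟨d, hd, hxz⟩ := hγ.exists_neg_of_det_eq_zero (ne_add_int_of_lt hz hz1) h'
  have h1 := mul_pos hc (hγ.strictly_convex y z hzy)
  have h2 := mul_pos hd (hγ.strictly_convex z y (ne_add_int_symm hzy))
  have e1 : c * det (deriv γ y) (γ z - γ y) = -det (deriv γ x) (γ z - γ y) := by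
    rw [hxy, det_smul_left]; ring
  have e2 : d * det (deriv γ z) (γ y - γ z) = -det (deriv γ x) (γ y - γ z) := by
    rw [hxz, det_smul_left]; ring
  rw [e1, det_sub_right] at h1
  rw [e2, det_sub_right] at h2
  linarith

/-- The tangent at `γ y` is reached from the tangent at `γ x` by a counterclockwise rotation
through an angle strictly between `0` and `π`; equivalently, the two tangent lines meet ahead of
`γ x` and behind `γ y`. The parameters are representatives with `x < y < x + 1`. -/
def Turn (γ : ℝ → Plane) (x y : ℝ) : Prop :=
  x < y ∧ y < x + 1 ∧ 0 < det (deriv γ x) (deriv γ y)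

theorem Turn.of_lt_right (hγ : IsOval γ) {x y z : ℝ} (h : Turn γ x z) (hxy : x < y)
    (hyz : y < z) : Turn γ x y := by
  obtain ⟨hxz, hz1, hd⟩ := h
  refine ⟨hxy, by linarith, ?_⟩
  by_contra! hn
  have hcont := hγ.continuous_det_deriv (deriv γ x)
  obtain ⟨p, ⟨hp, hp'⟩, hp0⟩ :=
    intermediate_value_Icc hyz.le hcont.continuousOn (Set.mem_Icc.2 ⟨hn, hd.le⟩)
  -- the distance from the tangent line at `γ x` returns to `0` at `x + 1`, so it has to decrease
  -- somewhere after `z`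
  obtain ⟨w, ⟨hw, hw'⟩, hw0⟩ := exists_hasDerivAt_eq_slope (fun t => det (deriv γ x) (γ t - γ x))
    (fun t => det (deriv γ x) (deriv γ t)) hz1
    (fun t _ => (hγ.hasDerivAt_det _ _ t).continuousAt.continuousWithinAt)
    (fun t _ => hγ.hasDerivAt_det _ _ t)
  have hneg : det (deriv γ x) (deriv γ w) < 0 := by
    rw [hw0, hγ.periodic x]
    refine div_neg_of_neg_of_pos ?_ (by linarith)
    have := hγ.strictly_convex x z (ne_add_int_of_lt hxz hz1)
    simpa [det] using this
  obtain ⟨q, ⟨hq, hq'⟩, hq0⟩ :=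
    intermediate_value_Icc' hw.le hcont.continuousOn (Set.mem_Icc.2 ⟨hneg.le, hd.le⟩)
  have hpq := hγ.eq_of_det_eq_zero (by linarith) (by linarith) (by linarith) (by linarith) hp0 hq0
  have : p = z := by linarith
  rw [this] at hp0
  exact hd.ne' hp0

theorem Turn.of_lt_left (hγ : IsOval γ) {x y z : ℝ} (h : Turn γ x z) (hxy : x < y)
    (hyz : y < z) : Turn γ y z := by
  have hxy' := h.of_lt_right hγ hxy hyz
  obtain ⟨hxz, hz1, hd⟩ := h
  refine ⟨hyz, by linarith, ?_⟩
  by_contra! hn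
  rcases hn.lt_or_eq with hn | hn
  · have ht : Turn γ z (y + 1) :=
      ⟨by linarith, by linarith, by rw [deriv_add_one hγ.periodic, det_swap]; linarith⟩
    have := (ht.of_lt_right hγ hz1 (by linarith)).2.2
    rw [deriv_add_one hγ.periodic, det_swap] at this
    linarith
  · obtain ⟨c, hc, e⟩ :=
      hγ.exists_neg_of_det_eq_zero (ne_add_int_of_lt hyz (by linarith)) hn
    have := hxy'.2.2
    rw [e, det_smul_right] at this
    nlinarith

/-- Two consecutive turns do not go around the oval. -/
theorem Turn.lt_add_one (hγ : IsOval γ) {x y z : ℝ} (h : Turn γ x y) (h' : Turn γ y z) :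
    z < x + 1 := by
  by_contra! hn
  have : 0 < det (deriv γ y) (deriv γ (x + 1)) := by
    rcases hn.eq_or_lt with hn | hn
    · rw [hn]; exact h'.2.2
    · exact (h'.of_lt_right hγ h.2.1 hn).2.2
  rw [deriv_add_one hγ.periodic, det_swap] at this
  linarith [h.2.2]

theorem Turn.add_one (hγ : IsOval γ) {x y : ℝ} (h : Turn γ x y) : Turn γ (x + 1) (y + 1) :=
  ⟨by linarith [h.1], by linarith [h.2.1], by
    simpa only [deriv_add_one hγ.periodic] using h.2.2⟩

/-! ### The radii of the tangent circles -/

/-- The unit tangent vector at `γ x`. -/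
noncomputable def unitTangent (γ : ℝ → Plane) (x : ℝ) : Plane := ‖deriv γ x‖⁻¹ • deriv γ x

theorem IsOval.norm_unitTangent (hγ : IsOval γ) (x : ℝ) : ‖unitTangent γ x‖ = 1 :=
  norm_smul_inv_norm (𝕜 := ℝ) (hγ.deriv_ne_zero x)

theorem IsOval.inv_norm_pos (hγ : IsOval γ) (x : ℝ) : 0 < ‖deriv γ x‖⁻¹ :=
  inv_pos.2 (norm_pos_iff.2 (hγ.deriv_ne_zero x))

theorem unitTangent_add_one (h : Function.Periodic γ 1) (x : ℝ) :
    unitTangent γ (x + 1) = unitTangent γ x := by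
  rw [unitTangent, deriv_add_one h, unitTangent]

theorem IsOval.det_unitTangent_pos (hγ : IsOval γ) {x y : ℝ} (h : ∀ k : ℤ, y ≠ x + k) :
    0 < det (unitTangent γ x) (γ y - γ x) := by
  rw [unitTangent, det_smul_left]
  exact mul_pos (hγ.inv_norm_pos x) (hγ.strictly_convex x y h)

theorem Turn.det_pos (hγ : IsOval γ) {x y : ℝ} (h : Turn γ x y) :
    0 < det (unitTangent γ x) (unitTangent γ y) := by
  rw [unitTangent, unitTangent, det_smul_left, det_smul_right]
  exact mul_pos (hγ.inv_norm_pos x) (mul_pos (hγ.inv_norm_pos y) h.2.2)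

/-- The radius of the circle that touches the oval from outside at `γ x` and is tangent to the
tangent line at `γ y`, for a turn from `x` to `y`: the distance from `γ x` to the tangent line
at `γ y`, divided by `1 + cos δ`, where `δ` is the angle of the turn. -/
noncomputable def forwardRadius (γ : ℝ → Plane) (x y : ℝ) : ℝ :=
  det (unitTangent γ y) (γ x - γ y) / (1 + inner ℝ (unitTangent γ x) (unitTangent γ y))

/-- The radius of the circle that touches the oval from outside at `γ y` and is tangent to the
tangent line at `γ x`, for a turn from `x` to `y`. -/
noncomputable def backwardRadius (γ : ℝ → Plane) (x y : ℝ) : ℝ :=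
  det (unitTangent γ x) (γ y - γ x) / (1 + inner ℝ (unitTangent γ x) (unitTangent γ y))

theorem forwardRadius_add_one (h : Function.Periodic γ 1) (x y : ℝ) :
    forwardRadius γ (x + 1) (y + 1) = forwardRadius γ x y := by
  simp only [forwardRadius, unitTangent_add_one h, h x, h y]

/-- The chord of a turn is the sum of the two tangent segments, of lengths `a` and `b`. -/
theorem Turn.exists_chord (hγ : IsOval γ) {x y : ℝ} (h : Turn γ x y) :
    ∃ a b : ℝ, 0 < a ∧ 0 < b ∧ γ y - γ x = a • unitTangent γ x + b • unitTangent γ y := by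
  have hd := h.det_pos hγ
  have hne := ne_add_int_of_lt h.1 h.2.1
  have hb := hγ.det_unitTangent_pos hne
  have ha := hγ.det_unitTangent_pos (ne_add_int_symm hne)
  rw [← neg_sub, ← neg_one_smul ℝ, det_smul_right, neg_one_mul, ← det_swap] at ha
  refine ⟨_, _, div_pos ha hd, div_pos hb hd, ?_⟩
  rw [div_eq_inv_mul, div_eq_inv_mul, mul_smul, mul_smul, ← smul_add, eq_inv_smul_iff₀ hd.ne']
  exact det_smul_eq _ _ _

theorem forwardRadius_eq_of_chord {x y a b : ℝ}
    (h : γ y - γ x = a • unitTangent γ x + b • unitTangent γ y) :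
    forwardRadius γ x y = a * (det (unitTangent γ x) (unitTangent γ y) /
      (1 + inner ℝ (unitTangent γ x) (unitTangent γ y))) := by
  rw [forwardRadius, ← neg_sub, h, ← neg_one_smul ℝ, det_smul_right, det_add_right,
    det_smul_right, det_smul_right, det_self, det_swap]
  ring

theorem backwardRadius_eq_of_chord {x y a b : ℝ}
    (h : γ y - γ x = a • unitTangent γ x + b • unitTangent γ y) :
    backwardRadius γ x y = b * (det (unitTangent γ x) (unitTangent γ y) /
      (1 + inner ℝ (unitTangent γ x) (unitTangent γ y))) := by
  rw [backwardRadius, h, det_add_right, det_smul_right, det_smul_right, det_self]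
  ring

/-- As the second tangent turns to the left, both factors of `a * tan (δ / 2)` increase. -/
theorem Turn.forwardRadius_lt_right (hγ : IsOval γ) {x y z : ℝ} (h : Turn γ x z) (hxy : x < y)
    (hyz : y < z) : forwardRadius γ x y < forwardRadius γ x z := by
  have h1 := h.of_lt_right hγ hxy hyz
  have h2 := h.of_lt_left hγ hxy hyz
  obtain ⟨a, b, ha, hb, e⟩ := h1.exists_chord hγ
  obtain ⟨a', b', ha', hb', e'⟩ := h.exists_chord hγ
  rw [forwardRadius_eq_of_chord e, forwardRadius_eq_of_chord e']
  have hlt : a < a' := by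
    have hc := hγ.det_unitTangent_pos (ne_add_int_symm (ne_add_int_of_lt h2.1 h2.2.1))
    rw [← sub_sub_sub_cancel_right _ _ (γ x), e, e', det_sub_right, det_add_right, det_add_right,
      det_smul_right, det_smul_right, det_smul_right, det_smul_right, det_self,
      det_swap _ (unitTangent γ x), det_swap _ (unitTangent γ y)] at hc
    nlinarith [h.det_pos hγ, mul_pos hb (h2.det_pos hγ)]
  refine mul_lt_mul'' hlt (tan_half_lt_left (hγ.norm_unitTangent _) (hγ.norm_unitTangent _)
    (hγ.norm_unitTangent _) (h1.det_pos hγ) (h2.det_pos hγ) (h.det_pos hγ)) ha.le ?_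
  exact (div_pos (h1.det_pos hγ) (one_add_inner_pos (hγ.norm_unitTangent _)
    (hγ.norm_unitTangent _) (h1.det_pos hγ))).le

theorem Turn.backwardRadius_lt_left (hγ : IsOval γ) {x y z : ℝ} (h : Turn γ x z) (hxy : x < y)
    (hyz : y < z) : backwardRadius γ y z < backwardRadius γ x z := by
  have h1 := h.of_lt_right hγ hxy hyz
  have h2 := h.of_lt_left hγ hxy hyz
  obtain ⟨a, b, ha, hb, e⟩ := h2.exists_chord hγ
  obtain ⟨a', b', ha', hb', e'⟩ := h.exists_chord hγ
  rw [backwardRadius_eq_of_chord e, backwardRadius_eq_of_chord e']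
  have hlt : b < b' := by
    have hc := hγ.det_unitTangent_pos (ne_add_int_of_lt h1.1 h1.2.1)
    rw [← sub_sub_sub_cancel_left _ _ (γ z), e, e', det_sub_right, det_add_right, det_add_right,
      det_smul_right, det_smul_right, det_smul_right, det_smul_right, det_self] at hc
    nlinarith [h.det_pos hγ, mul_pos ha (h1.det_pos hγ)]
  refine mul_lt_mul'' hlt (tan_half_lt_right (hγ.norm_unitTangent _) (hγ.norm_unitTangent _)
    (hγ.norm_unitTangent _) (h1.det_pos hγ) (h2.det_pos hγ) (h.det_pos hγ)) hb.le ?_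
  exact (div_pos (h2.det_pos hγ) (one_add_inner_pos (hγ.norm_unitTangent _)
    (hγ.norm_unitTangent _) (h2.det_pos hγ))).le

/-- As `γ y` moves towards the second tangent line, the distance to that line decreases, and so
does the angle of the turn. -/
theorem Turn.forwardRadius_lt_left (hγ : IsOval γ) {x y z : ℝ} (h : Turn γ x z) (hxy : x < y)
    (hyz : y < z) : forwardRadius γ y z < forwardRadius γ x z := by
  have h1 := h.of_lt_right hγ hxy hyz
  have h2 := h.of_lt_left hγ hxy hyz
  obtain ⟨a, b, ha, hb, e⟩ := h1.exists_chord hγ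
  have hin := inner_lt_inner_right (hγ.norm_unitTangent _) (hγ.norm_unitTangent _)
    (h1.det_pos hγ) (h2.det_pos hγ) (h.det_pos hγ)
  have hp := one_add_inner_pos (hγ.norm_unitTangent _) (hγ.norm_unitTangent _) (h.det_pos hγ)
  refine div_lt_div₀ ?_ (by linarith) ?_ hp
  · have e2 : γ y - γ z = (γ x - γ z) + (γ y - γ x) := by abel
    rw [e2, e, det_add_right, det_add_right, det_smul_right, det_smul_right,
      det_swap _ (unitTangent γ x), det_swap _ (unitTangent γ y)]
    nlinarith [mul_pos ha (h.det_pos hγ), mul_pos hb (h2.det_pos hγ)]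
  · exact (hγ.det_unitTangent_pos (ne_add_int_symm (ne_add_int_of_lt h.1 h.2.1))).le

theorem Turn.backwardRadius_lt_right (hγ : IsOval γ) {x y z : ℝ} (h : Turn γ x z) (hxy : x < y)
    (hyz : y < z) : backwardRadius γ x y < backwardRadius γ x z := by
  have h1 := h.of_lt_right hγ hxy hyz
  have h2 := h.of_lt_left hγ hxy hyz
  obtain ⟨a, b, ha, hb, e⟩ := h2.exists_chord hγ
  have hin := inner_lt_inner_left (hγ.norm_unitTangent _) (hγ.norm_unitTangent _)
    (h1.det_pos hγ) (h2.det_pos hγ) (h.det_pos hγ)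
  have hp := one_add_inner_pos (hγ.norm_unitTangent _) (hγ.norm_unitTangent _) (h.det_pos hγ)
  refine div_lt_div₀ ?_ (by linarith) ?_ hp
  · have e2 : γ z - γ x = (γ y - γ x) + (γ z - γ y) := by abel
    rw [e2, e, det_add_right, det_add_right, det_smul_right, det_smul_right]
    nlinarith [mul_pos ha (h1.det_pos hγ), mul_pos hb (h.det_pos hγ)]
  · exact (hγ.det_unitTangent_pos (ne_add_int_of_lt h.1 h.2.1)).le

/-! ### Tangent circles and the billiard map -/

theorem isTangentAt_tangentLine {x : ℝ} {p : Plane} {C : EuclideanGeometry.Sphere Plane}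
    (h : C.IsTangentAt p (tangentLine γ x)) :
    (∃ s : ℝ, p = γ x + s • deriv γ x) ∧ inner ℝ (unitTangent γ x) (C.center - p) = 0 ∧
      ‖C.center - p‖ = C.radius := by
  obtain ⟨s, hs⟩ := Submodule.mem_span_singleton.1 (AffineSubspace.mem_mk'.1 h.mem_space)
  rw [vsub_eq_sub] at hs
  have hp : p = γ x + s • deriv γ x := by rw [hs]; abel
  refine ⟨⟨s, hp⟩, ?_, ?_⟩
  · have h0 := h.inner_left_eq_zero_of_mem (AffineSubspace.self_mem_mk' (γ x) _)
    have h1 := h.inner_left_eq_zero_of_mem (x := deriv γ x +ᵥ γ x)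
      (AffineSubspace.vadd_mem_mk' _ (Submodule.mem_span_singleton_self _))
    rw [vadd_vsub_assoc, inner_add_left, h0, add_zero, vsub_eq_sub] at h1
    rw [← neg_sub, inner_neg_right, unitTangent, inner_smul_left, h1, mul_zero, neg_zero]
  · rw [← dist_eq_norm, dist_comm]
    exact EuclideanGeometry.mem_sphere.1 h.mem_sphere

/-- A line tangent to a circle lies at distance `radius` from its centre. -/
theorem IsOval.det_sq_eq_of_isTangent (hγ : IsOval γ) {x : ℝ}
    {C : EuclideanGeometry.Sphere Plane} (h : C.IsTangent (tangentLine γ x)) :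
    det (unitTangent γ x) (C.center - γ x) ^ 2 = C.radius ^ 2 := by
  obtain ⟨p, hp⟩ := h
  obtain ⟨⟨s, hs⟩, hi, hr⟩ := isTangentAt_tangentLine hp
  have hL := inner_sq_add_det_sq (unitTangent γ x) (C.center - p)
  rw [hi, hr, hγ.norm_unitTangent] at hL
  have e : C.center - γ x = (C.center - p) + s • deriv γ x := by rw [hs]; abel
  have e0 : det (unitTangent γ x) (deriv γ x) = 0 := by
    rw [unitTangent, det_smul_left, det_self, mul_zero]
  rw [e, det_add_right, det_smul_right, e0]
  linear_combination hL

/-- The solutions of `(h - r cos δ)² = r²` are `r = h / (1 + cos δ)` and `r = -h / (1 - cos δ)`;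
only the first one is positive. -/
theorem eq_div_of_sq_eq {h r c : ℝ} (hh : 0 < h) (hr : 0 < r) (hc : c < 1) (hc' : 0 < 1 + c)
    (e : (h - r * c) ^ 2 = r ^ 2) : h / (1 + c) = r := by
  rw [div_eq_iff hc'.ne']
  rcases sq_eq_sq_iff_eq_or_eq_neg.1 e with e | e
  · linarith
  · nlinarith [mul_pos hr (sub_pos.2 hc)]

/-- If a circle touches the oval from outside at `γ y`, then its centre is the point
`γ y - r n`, where `n` is the unit normal at `γ y` pointing inwards. -/
theorem IsOval.det_center_sub (hγ : IsOval γ) {y : ℝ} {C : EuclideanGeometry.Sphere Plane}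
    (hr : 0 < C.radius) (ht : C.IsTangentAt (γ y) (tangentLine γ y))
    (hs : det (deriv γ y) (C.center - γ y) < 0) (X V : Plane) :
    det X (C.center - V) = det X (γ y - V) - C.radius * inner ℝ X (unitTangent γ y) := by
  obtain ⟨-, hi, hn⟩ := isTangentAt_tangentLine ht
  have hL := inner_sq_add_det_sq (unitTangent γ y) (C.center - γ y)
  have hs' : det (unitTangent γ y) (C.center - γ y) < 0 := by
    rw [unitTangent, det_smul_left]
    exact mul_neg_of_pos_of_neg (hγ.inv_norm_pos y) hs
  have hd : det (unitTangent γ y) (C.center - γ y) = -C.radius := by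
    rw [hi, hn, hγ.norm_unitTangent] at hL
    rcases sq_eq_sq_iff_eq_or_eq_neg.1
      (show det (unitTangent γ y) (C.center - γ y) ^ 2 = C.radius ^ 2 by linarith) with h | h
    · linarith
    · exact h
  have hu := coord_sq_of_norm_eq_one (hγ.norm_unitTangent y)
  rw [← sub_add_sub_cancel C.center (γ y) V, det_add_right]
  generalize C.center - γ y = w at *
  generalize unitTangent γ y = Y at *
  rw [inner_eq_coord] at hi ⊢
  simp only [det] at hd ⊢
  linear_combination (-(X 0 * w 1 - X 1 * w 0)) * hu + (X 0 * Y 0 + X 1 * Y 1) * hd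
    + (X 0 * Y 1 - X 1 * Y 0) * hi

/-- The circle in the definition of the billiard map has the same radius, whether it is
computed from the tangent line before or from the one after its point of contact. -/
theorem IsOval.backwardRadius_eq_forwardRadius (hγ : IsOval γ) {x y z : ℝ} (hxy : Turn γ x y)
    (hyz : Turn γ y z) {C : EuclideanGeometry.Sphere Plane}
    (hr : 0 < C.radius) (ht : C.IsTangentAt (γ y) (tangentLine γ y))
    (hs : det (deriv γ y) (C.center - γ y) < 0) (hx : C.IsTangent (tangentLine γ x))
    (hz : C.IsTangent (tangentLine γ z)) : backwardRadius γ x y = forwardRadius γ y z := by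
  have h1 := hγ.det_sq_eq_of_isTangent hx
  have h2 := hγ.det_sq_eq_of_isTangent hz
  rw [hγ.det_center_sub hr ht hs] at h1 h2
  rw [real_inner_comm] at h2
  rw [backwardRadius, forwardRadius,
    eq_div_of_sq_eq (hγ.det_unitTangent_pos (ne_add_int_of_lt hxy.1 hxy.2.1)) hr ?_ ?_ h1,
    eq_div_of_sq_eq (hγ.det_unitTangent_pos (ne_add_int_symm (ne_add_int_of_lt hyz.1 hyz.2.1)))
      hr ?_ ?_ h2]
  · exact inner_lt_one (hγ.norm_unitTangent _) (hγ.norm_unitTangent _) (hyz.det_pos hγ)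
  · exact one_add_inner_pos (hγ.norm_unitTangent _) (hγ.norm_unitTangent _) (hyz.det_pos hγ)
  · exact inner_lt_one (hγ.norm_unitTangent _) (hγ.norm_unitTangent _) (hxy.det_pos hγ)
  · exact one_add_inner_pos (hγ.norm_unitTangent _) (hγ.norm_unitTangent _) (hxy.det_pos hγ)

theorem tangentLine_add_int (h : Function.Periodic γ 1) (x : ℝ) (k : ℤ) :
    tangentLine γ (x + k) = tangentLine γ x := by
  simp only [tangentLine, apply_add_int h, deriv_add_int h]

theorem IsAhead.add_int (h : Function.Periodic γ 1) {x : ℝ} {M : Plane} (hM : IsAhead γ x M)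
    (k : ℤ) : IsAhead γ (x + k) M := by
  simpa only [IsAhead, apply_add_int h, deriv_add_int h] using hM

theorem IsBehind.add_int (h : Function.Periodic γ 1) {x : ℝ} {M : Plane} (hM : IsBehind γ x M)
    (k : ℤ) : IsBehind γ (x + k) M := by
  simpa only [IsBehind, apply_add_int h, deriv_add_int h] using hM

theorem IsOval.forall_ne_of_isAhead_of_isBehind (hγ : IsOval γ) {x y : ℝ} {M : Plane}
    (hx : IsAhead γ x M) (hy : IsBehind γ y M) (k : ℤ) : y ≠ x + k := by
  rintro rfl
  obtain ⟨l, hl, rfl⟩ := hx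
  obtain ⟨m, hm, e⟩ := hy
  rw [apply_add_int hγ.periodic, deriv_add_int hγ.periodic] at e
  have : (l + m) • deriv γ x = 0 := by
    rw [add_smul]
    linear_combination (norm := module) e
  rcases smul_eq_zero.1 this with h | h
  · linarith
  · exact hγ.deriv_ne_zero x h

theorem IsOval.turn_of_isAhead_of_isBehind (hγ : IsOval γ) {x y : ℝ} {M : Plane} (hxy : x < y)
    (hy1 : y < x + 1) (hx : IsAhead γ x M) (hy : IsBehind γ y M) : Turn γ x y := by
  refine ⟨hxy, hy1, ?_⟩
  have h := hγ.strictly_convex x y (ne_add_int_of_lt hxy hy1)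
  obtain ⟨l, hl, rfl⟩ := hx
  obtain ⟨m, hm, e⟩ := hy
  have e' : γ y - γ x = l • deriv γ x + m • deriv γ y := by
    linear_combination (norm := module) -e
  rw [e', det_add_right, det_smul_right, det_smul_right, det_self, mul_zero, zero_add] at h
  exact pos_of_mul_pos_right h hm.le

theorem IsOval.exists_eq_add_int_of_isAhead (hγ : IsOval γ) {x y : ℝ} {M : Plane}
    (hx : IsAhead γ x M) (hy : IsAhead γ y M) : ∃ k : ℤ, y = x + k := by
  by_contra! hne
  have h1 := hγ.strictly_convex x y hne
  have h2 := hγ.strictly_convex y x (ne_add_int_symm hne)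
  obtain ⟨l, hl, rfl⟩ := hx
  obtain ⟨m, hm, e⟩ := hy
  have e1 : γ y - γ x = l • deriv γ x - m • deriv γ y := by
    linear_combination (norm := module) -e
  rw [e1, det_sub_right, det_smul_right, det_smul_right, det_self] at h1
  rw [← neg_sub, e1, neg_sub, det_sub_right, det_smul_right, det_smul_right, det_self,
    det_swap] at h2
  nlinarith

theorem IsOval.exists_eq_add_int_of_isBehind (hγ : IsOval γ) {x y : ℝ} {M : Plane}
    (hx : IsBehind γ x M) (hy : IsBehind γ y M) : ∃ k : ℤ, y = x + k := by
  by_contra! hne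
  have h1 := hγ.strictly_convex x y hne
  have h2 := hγ.strictly_convex y x (ne_add_int_symm hne)
  obtain ⟨l, hl, rfl⟩ := hx
  obtain ⟨m, hm, e⟩ := hy
  have e1 : γ y - γ x = m • deriv γ y - l • deriv γ x := by
    linear_combination (norm := module) -e
  rw [e1, det_sub_right, det_smul_right, det_smul_right, det_self] at h1
  rw [← neg_sub, e1, neg_sub, det_sub_right, det_smul_right, det_smul_right, det_self,
    det_swap] at h2
  nlinarith

theorem IsOval.eq_of_isBehind (hγ : IsOval γ) {x y z : ℝ} {M : Plane} (hy : Turn γ x y)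
    (hz : Turn γ x z) (hyM : IsBehind γ y M) (hzM : IsBehind γ z M) : z = y := by
  obtain ⟨k, rfl⟩ := hγ.exists_eq_add_int_of_isBehind hyM hzM
  have h1 : (-1 : ℝ) < k := by linarith [hy.2.1, hz.1]
  have h2 : (k : ℝ) < 1 := by linarith [hy.1, hz.2.1]
  norm_cast at h1 h2
  obtain rfl : k = 0 := by omega
  simp

/-- One step of the billiard map: if the tangent lines from `M` touch the oval at `γ x` and `γ y`,
those from the image `M'` touch it at `γ y` and `γ z`. -/
theorem Maps.exists_turn (hγ : IsOval γ) {M M' : Plane} (h : Maps γ M M') {x y : ℝ}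
    (hxy : Turn γ x y) (hx : IsAhead γ x M) (hy : IsBehind γ y M) :
    IsAhead γ y M' ∧ ∃ z, Turn γ y z ∧ IsBehind γ z M' ∧
      backwardRadius γ x y = forwardRadius γ y z := by
  obtain ⟨x₁, x₂, x₃, C, h1, h2, hr, ht, hs, htx, h3, h4, htz⟩ := h
  obtain ⟨k, rfl⟩ := hγ.exists_eq_add_int_of_isAhead hx h1
  obtain ⟨j, rfl⟩ := hγ.exists_eq_add_int_of_isBehind hy h2
  rw [tangentLine_add_int hγ.periodic, apply_add_int hγ.periodic] at ht
  rw [deriv_add_int hγ.periodic, apply_add_int hγ.periodic] at hs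
  rw [tangentLine_add_int hγ.periodic] at htx
  have hyM : IsAhead γ y M' := by simpa using h3.add_int hγ.periodic (-j)
  obtain ⟨i, hi, hi'⟩ :=
    exists_add_int_of_forall_ne (hγ.forall_ne_of_isAhead_of_isBehind hyM h4)
  have hz := h4.add_int hγ.periodic i
  have hyz := hγ.turn_of_isAhead_of_isBehind hi hi' hyM hz
  rw [← tangentLine_add_int hγ.periodic x₃ i] at htz
  exact ⟨hyM, _, hyz, hz, hγ.backwardRadius_eq_forwardRadius hxy hyz hr ht hs htx htz⟩

theorem Maps.exists_first_turn (hγ : IsOval γ) {M M' : Plane} (h : Maps γ M M') {x : ℝ}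
    (hx : IsAhead γ x M) : ∃ y, Turn γ x y ∧ IsBehind γ y M := by
  obtain ⟨x₁, x₂, -, -, -, h2, -⟩ := h
  obtain ⟨k, hk, hk'⟩ :=
    exists_add_int_of_forall_ne (hγ.forall_ne_of_isAhead_of_isBehind hx h2)
  have h2' := h2.add_int hγ.periodic k
  exact ⟨_, hγ.turn_of_isAhead_of_isBehind hk hk' hx h2', h2'⟩


/-! ### Periodic orbits of periods three and four -/

/-- The circumscribed triangle with tangent points `γ x`, `γ y`, `γ z`, winding once around the
oval, is a billiard orbit: at each tangent point the two radii agree. -/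
structure IsTriangleOrbit (γ : ℝ → Plane) (x y z : ℝ) : Prop where
  turn_xy : Turn γ x y
  turn_yz : Turn γ y z
  turn_zx : Turn γ z (x + 1)
  radius_x : backwardRadius γ z (x + 1) = forwardRadius γ x y
  radius_y : backwardRadius γ x y = forwardRadius γ y z
  radius_z : backwardRadius γ y z = forwardRadius γ z (x + 1)

/-- The circumscribed quadrilateral with tangent points `γ x`, `γ y`, `γ z`, `γ w`, winding once
around the oval, is a billiard orbit: at each tangent point the two radii agree. -/
structure IsQuadrilateralOrbit (γ : ℝ → Plane) (x y z w : ℝ) : Prop where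
  turn_xy : Turn γ x y
  turn_yz : Turn γ y z
  turn_zw : Turn γ z w
  turn_wx : Turn γ w (x + 1)
  radius_x : backwardRadius γ w (x + 1) = forwardRadius γ x y
  radius_y : backwardRadius γ x y = forwardRadius γ y z
  radius_z : backwardRadius γ y z = forwardRadius γ z w
  radius_w : backwardRadius γ z w = forwardRadius γ w (x + 1)

/-- If the second tangent point advances, then the last one has to move back. -/
theorem lt_of_radius_eq (hγ : IsOval γ) {x y y' w w' : ℝ} (hw : Turn γ w (x + 1))
    (hw' : Turn γ w' (x + 1)) (hy' : Turn γ x y') (hxy : x < y)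
    (e : backwardRadius γ w (x + 1) = forwardRadius γ x y)
    (e' : backwardRadius γ w' (x + 1) = forwardRadius γ x y') (hlt : y < y') : w' < w := by
  have h := hy'.forwardRadius_lt_right hγ hxy hlt
  rw [← e, ← e'] at h
  by_contra! hn
  rcases hn.eq_or_lt with rfl | hn
  · exact h.false
  · exact (hw.backwardRadius_lt_left hγ hn hw'.1).not_gt h

/-- If the second tangent point advances, then the third one has to advance. -/
theorem lt_of_radius_eq' (hγ : IsOval γ) {x y y' z z' : ℝ} (hxy : x < y) (hy' : Turn γ x y')
    (hz : Turn γ y z) (hz' : Turn γ y' z')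
    (e : backwardRadius γ x y = forwardRadius γ y z)
    (e' : backwardRadius γ x y' = forwardRadius γ y' z') (hlt : y < y') : z < z' := by
  have h := hy'.backwardRadius_lt_right hγ hxy hlt
  rw [e, e'] at h
  by_contra! hn
  have h2 := hz.forwardRadius_lt_left hγ hlt (hz'.1.trans_le hn)
  rcases hn.eq_or_lt with rfl | hn
  · exact h2.not_gt h
  · have h3 := (hz.of_lt_left hγ hlt (hz'.1.trans hn)).forwardRadius_lt_right hγ hz'.1 hn
    exact (h3.trans h2).not_gt h

/-- Given its first tangent point, a triangular orbit has at most one second point: if the second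
point advanced, the third one would have to move both back and forth. -/
theorem IsTriangleOrbit.le (hγ : IsOval γ) {x y z y' z' : ℝ} (h : IsTriangleOrbit γ x y z)
    (h' : IsTriangleOrbit γ x y' z') : y' ≤ y := by
  by_contra! hlt
  have h1 := lt_of_radius_eq hγ h.turn_zx h'.turn_zx h'.turn_xy h.turn_xy.1 h.radius_x h'.radius_x
    hlt
  have h2 := lt_of_radius_eq' hγ h.turn_xy.1 h'.turn_xy h.turn_yz h'.turn_yz h.radius_y h'.radius_y
    hlt
  exact h1.not_gt h2

/-- If the second point advanced, the third one would advance and the fourth one would move back;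
then the two radii at the fourth point would change in opposite directions. -/
theorem IsQuadrilateralOrbit.le (hγ : IsOval γ) {x y z w y' z' w' : ℝ}
    (h : IsQuadrilateralOrbit γ x y z w) (h' : IsQuadrilateralOrbit γ x y' z' w') : y' ≤ y := by
  by_contra! hlt
  have hw := lt_of_radius_eq hγ h.turn_wx h'.turn_wx h'.turn_xy h.turn_xy.1 h.radius_x h'.radius_x
    hlt
  have hz := lt_of_radius_eq' hγ h.turn_xy.1 h'.turn_xy h.turn_yz h'.turn_yz h.radius_y h'.radius_y
    hlt
  have h1 := h'.turn_wx.forwardRadius_lt_left hγ hw h.turn_wx.1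
  have hzw := h'.turn_zw.1
  have h2 := h.turn_zw.backwardRadius_lt_left hγ hz (hzw.trans hw)
  have h3 := (h.turn_zw.of_lt_left hγ hz (hzw.trans hw)).backwardRadius_lt_right hγ hzw hw
  rw [h.radius_w] at h2
  rw [h'.radius_w] at h3
  linarith

theorem eq_add_one_of_lt {x w : ℝ} {k : ℤ} (hw : w = x + k) (h1 : x < w) (h2 : w < x + 2) :
    w = x + 1 := by
  have h1 : (0 : ℝ) < k := by linarith
  have h2 : (k : ℝ) < 2 := by linarith
  norm_cast at h1 h2
  obtain rfl : k = 1 := by omega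
  simpa using hw

/-- A 3-periodic billiard orbit closes up after one revolution: two consecutive turns advance the
parameter by less than `1`, and so three of them by less than `2`. -/
theorem IsOval.exists_isTriangleOrbit (hγ : IsOval γ) {M : Plane} (hM : M ∈ periodicPoints γ 3)
    {x : ℝ} (hx : IsAhead γ x M) : ∃ y z, IsBehind γ y M ∧ IsTriangleOrbit γ x y z := by
  obtain ⟨-, P, h0, h3, hP⟩ := hM
  have m0 := hP 0 (by norm_num)
  have m1 := hP 1 (by norm_num)
  have m2 := hP 2 (by norm_num)
  rw [h0] at m0
  norm_num [h3] at m0 m1 m2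
  obtain ⟨y, hxy, hy⟩ := m0.exists_first_turn hγ hx
  obtain ⟨hy1, z, hyz, hz, ey⟩ := m0.exists_turn hγ hxy hx hy
  obtain ⟨hz2, w, hzw, hw, ez⟩ := m1.exists_turn hγ hyz hy1 hz
  obtain ⟨hw3, v, hwv, hv, ew⟩ := m2.exists_turn hγ hzw hz2 hw
  obtain ⟨k, hk⟩ := hγ.exists_eq_add_int_of_isAhead hx hw3
  have b1 := hxy.lt_add_one hγ hyz
  obtain rfl := eq_add_one_of_lt hk (by linarith [hxy.1, hyz.1, hzw.1]) (by linarith [hzw.2.1])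
  obtain rfl := hγ.eq_of_isBehind (hxy.add_one hγ) hwv
    (by simpa using hy.add_int hγ.periodic 1) hv
  rw [forwardRadius_add_one hγ.periodic] at ew
  exact ⟨y, z, hy, hxy, hyz, hzw, ew, ey, ez⟩

/-- A 4-periodic billiard orbit closes up after one revolution, since two consecutive turns advance
the parameter by less than `1`. -/
theorem IsOval.exists_isQuadrilateralOrbit (hγ : IsOval γ) {M : Plane}
    (hM : M ∈ periodicPoints γ 4) {x : ℝ} (hx : IsAhead γ x M) :
    ∃ y z w, IsBehind γ y M ∧ IsQuadrilateralOrbit γ x y z w := by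
  obtain ⟨-, P, h0, h4, hP⟩ := hM
  have m0 := hP 0 (by norm_num)
  have m1 := hP 1 (by norm_num)
  have m2 := hP 2 (by norm_num)
  have m3 := hP 3 (by norm_num)
  rw [h0] at m0
  norm_num [h4] at m0 m1 m2 m3
  obtain ⟨y, hxy, hy⟩ := m0.exists_first_turn hγ hx
  obtain ⟨hy1, z, hyz, hz, ey⟩ := m0.exists_turn hγ hxy hx hy
  obtain ⟨hz2, w, hzw, hw, ez⟩ := m1.exists_turn hγ hyz hy1 hz
  obtain ⟨hw3, v, hwv, hv, ew⟩ := m2.exists_turn hγ hzw hz2 hw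
  obtain ⟨hv4, u, hvu, hu, ev⟩ := m3.exists_turn hγ hwv hw3 hv
  obtain ⟨k, hk⟩ := hγ.exists_eq_add_int_of_isAhead hx hv4
  have b1 := hxy.lt_add_one hγ hyz
  have b2 := hzw.lt_add_one hγ hwv
  obtain rfl := eq_add_one_of_lt hk (by linarith [hxy.1, hyz.1, hzw.1, hwv.1]) (by linarith)
  obtain rfl := hγ.eq_of_isBehind (hxy.add_one hγ) hvu
    (by simpa using hy.add_int hγ.periodic 1) hu
  rw [forwardRadius_add_one hγ.periodic] at ev
  exact ⟨y, z, w, hy, hxy, hyz, hzw, hwv, ev, ey, ez, ew⟩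

/-- If, for the points of `S`, the second tangent point `γ y` is determined by the first one, then
`S` contains no two points on one ray of a tangent line, so it has no interior. -/
theorem interior_eq_empty_of_unique {S : Set Plane} {Q : ℝ → ℝ → Prop}
    (hS : ∀ M ∈ S, ∃ x, IsAhead γ x M)
    (hQ : ∀ M ∈ S, ∀ x, IsAhead γ x M → ∃ y, IsBehind γ y M ∧ Turn γ x y ∧ Q x y)
    (huniq : ∀ x y y', Q x y → Q x y' → y' ≤ y) : interior S = ∅ := by
  rw [Set.eq_empty_iff_forall_notMem]
  intro M hM
  obtain ⟨x, hx⟩ := hS M (interior_subset hM)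
  obtain ⟨ε, hε, hεS⟩ : ∃ ε : ℝ, 0 < ε ∧ M + ε • deriv γ x ∈ S := by
    have hc : Filter.Tendsto (fun ε : ℝ => M + ε • deriv γ x) (nhdsWithin 0 (Set.Ioi 0))
        (nhds M) := by
      have : Continuous fun ε : ℝ => M + ε • deriv γ x := by fun_prop
      simpa using (this.tendsto 0).mono_left nhdsWithin_le_nhds
    obtain ⟨ε, hεS, hε⟩ :=
      ((hc.eventually (mem_interior_iff_mem_nhds.1 hM)).and self_mem_nhdsWithin).exists
    exact ⟨ε, hε, hεS⟩
  have hx' : IsAhead γ x (M + ε • deriv γ x) := by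
    obtain ⟨l, hl, rfl⟩ := hx
    exact ⟨l + ε, by linarith, by module⟩
  obtain ⟨y, ⟨m, -, e⟩, hxy, hq⟩ := hQ M (interior_subset hM) x hx
  obtain ⟨y', ⟨m', -, e'⟩, -, hq'⟩ := hQ _ hεS x hx'
  obtain rfl : y' = y := le_antisymm (huniq _ _ _ hq hq') (huniq _ _ _ hq' hq)
  -- both points lie on the tangent line at `γ y`, which is transversal to the ray
  have e2 : ε • deriv γ x = (m - m') • deriv γ y' := by
    linear_combination (norm := module) e' - e
  have h := congrArg (fun v => det v (deriv γ y')) e2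
  simp only [det_smul_left, det_self, mul_zero] at h
  exact (mul_pos hε hxy.2.2).ne' h

theorem exists_isAhead_of_mem_periodicPoints {n : ℕ} (hn : 0 < n) {M : Plane}
    (hM : M ∈ periodicPoints γ n) : ∃ x, IsAhead γ x M := by
  obtain ⟨-, P, h0, -, hP⟩ := hM
  obtain ⟨x, -, -, -, hx, -⟩ := hP 0 hn
  exact ⟨x, h0 ▸ hx⟩

end Oval

end OuterLengthBilliard

theorem mainTheorem1 (γ : ℝ → OuterLengthBilliard.Plane) (hγ : OuterLengthBilliard.IsOval γ) :
    interior (OuterLengthBilliard.periodicPoints γ 3) = ∅ ∧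
      interior (OuterLengthBilliard.periodicPoints γ 4) = ∅ := by
  constructor
  · refine OuterLengthBilliard.interior_eq_empty_of_unique
      (Q := fun x y => ∃ z, OuterLengthBilliard.IsTriangleOrbit γ x y z)
      (fun M => OuterLengthBilliard.exists_isAhead_of_mem_periodicPoints (by norm_num)) ?_ ?_
    · intro M hM x hx
      obtain ⟨y, z, hy, h⟩ := hγ.exists_isTriangleOrbit hM hx
      exact ⟨y, hy, h.turn_xy, z, h⟩
    · rintro x y y' ⟨z, h⟩ ⟨z', h'⟩
      exact h.le hγ h'
  · refine OuterLengthBilliard.interior_eq_empty_of_unique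
      (Q := fun x y => ∃ z w, OuterLengthBilliard.IsQuadrilateralOrbit γ x y z w)
      (fun M => OuterLengthBilliard.exists_isAhead_of_mem_periodicPoints (by norm_num)) ?_ ?_
    · intro M hM x hx
      obtain ⟨y, z, w, hy, h⟩ := hγ.exists_isQuadrilateralOrbit hM hx
      exact ⟨y, hy, h.turn_xy, z, w, h⟩
    · rintro x y y' ⟨z, w, h⟩ ⟨z', w', h'⟩
      exact h.le hγ h'
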